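/- Let $K$ be a field and let $E=(E^0,E^1,r,s)$ be an arbitrary directed graph (vertex set $E^0$, edge set $E^1$, range and source maps $r,s:E^1\to E^0$). Let $L_K(E)$ be its Leavitt path algebra, that is, the (not necessarily unital) associative $K$-algebra generated by $\{v : v\in E^0\}\cup\{e,e^* : e\in E^1\}$ subject to the relations: $vw=\delta_{v,w}v$ for $v,w\in E^0$; $s(e)e=er(e)=e$ and $r(e)e^*=e^*s(e)=e^*$ for $e\in E^1$; $e^*f=\delta_{e,f}r(e)$ for $e,f\in E^1$; and $v=\sum_{s(e)=v}ee^*$ for every $v\in E^0$ with $s^{-1}(v)$ finite and nonempty. A cycle is a path $c=e_1\cdots e_n$ with $n\ge 1$ edges, $r(e_i)=s(e_{i+1})$ for $1\le i<n$, $r(e_n)=s(e_1)$, and $s(e_i)\ne s(e_j)$ for $i\neq j$; an exit for $c$ is an edge $f$ such that $s(f)=s(e_i)$ and $f\ne e_i$ for some $i$. Let $A=\bigoplus_{n\in\mathbb Z}A_n$ be a $\mathbb Z$-graded (associative, not necessarily unital) $K$-algebra and let $\pi:L_K(E)\to A$ be a ring homomorphism (not assumed $K$-linear, graded or unital) such that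 $\pi(v)\neq 0$ for every $v\in E^0$. Suppose that for every cycle $c$ without exits the element $\pi(c)$ is not nilpotent and lies in $A_n$ for some integer $n\neq 0$ (which may depend on $c$). Then $\pi$ is injective. -/

import Mathlib

/-- A directed graph `E = (E⁰, E¹, r, s)`: `V` is the set of vertices, `E` the set of edges, and
`s`, `r` are the source and range maps. Loops and parallel edges are allowed, and no finiteness or
countability is required. -/
structure DirectedGraph (V E : Type*) where
  /-- The source of an edge. -/
  s : E → V
  /-- The range of an edge. -/
  r : E → V

namespace DirectedGraph

variable {V E : Type*}

/-- The list `e₁, …, eₙ` is a cycle: `n ≥ 1`, `r(eᵢ) = s(eᵢ₊₁)` for `1 ≤ i < n`, `r(eₙ) = s(e₁)`,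
and the sources `s(e₁), …, s(eₙ)` are pairwise distinct. -/
def IsCycle (G : DirectedGraph V E) (c : List E) : Prop :=
  ∃ h : c ≠ [], c.IsChain (fun e f => G.r e = G.s f) ∧ G.r (c.getLast h) = G.s (c.head h) ∧
    (c.map G.s).Nodup

/-- The edge `f` is an exit for the path `e₁ ⋯ eₙ`: for some `i`, `s(f) = s(eᵢ)` and `f ≠ eᵢ`. -/
def IsExit (G : DirectedGraph V E) (f : E) (c : List E) : Prop :=
  ∃ e ∈ c, G.s f = G.s e ∧ f ≠ e

/-- The generators of the Leavitt path algebra: vertices, (real) edges, and ghost edges. -/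
inductive LeavittGen (V E : Type*) where
  | vertex : V → LeavittGen V E
  | edge : E → LeavittGen V E
  | ghost : E → LeavittGen V E

/-- The free associative (non-unital) `K`-algebra on a set `X`: the semigroup algebra of the free
semigroup (of nonempty words) on `X`. -/
abbrev FreeAssoc (K : Type*) [Field K] (X : Type*) := MonoidAlgebra K (FreeSemigroup X)

/-- A generator of the free associative algebra. -/
noncomputable def FreeAssoc.gen (K : Type*) [Field K] {X : Type*} (x : X) : FreeAssoc K X :=
  MonoidAlgebra.single (FreeSemigroup.of x) 1

section Relations

variable (K : Type*) [Field K]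

open FreeAssoc (gen) in
/-- The defining relations of the Leavitt path algebra of `G`. In `ck2`, the hypotheses say that
the vertex `v` is regular, i.e. that `s⁻¹(v)` is nonempty and finite. -/
inductive LeavittRel (G : DirectedGraph V E) :
    FreeAssoc K (LeavittGen V E) → FreeAssoc K (LeavittGen V E) → Prop
  | vertex_idem (v : V) : LeavittRel G (gen K (.vertex v) * gen K (.vertex v)) (gen K (.vertex v))
  | vertex_orth (v w : V) (h : v ≠ w) : LeavittRel G (gen K (.vertex v) * gen K (.vertex w)) 0
  | source_edge (e : E) : LeavittRel G (gen K (.vertex (G.s e)) * gen K (.edge e)) (gen K (.edge e))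
  | edge_range (e : E) : LeavittRel G (gen K (.edge e) * gen K (.vertex (G.r e))) (gen K (.edge e))
  | range_ghost (e : E) : LeavittRel G (gen K (.vertex (G.r e)) * gen K (.ghost e)) (gen K (.ghost e))
  | ghost_source (e : E) : LeavittRel G (gen K (.ghost e) * gen K (.vertex (G.s e))) (gen K (.ghost e))
  | ghost_edge_self (e : E) : LeavittRel G (gen K (.ghost e) * gen K (.edge e)) (gen K (.vertex (G.r e)))
  | ghost_edge_ne (e f : E) (h : e ≠ f) : LeavittRel G (gen K (.ghost e) * gen K (.edge f)) 0
  | ck2 (v : V) (hne : {e : E | G.s e = v}.Nonempty) (hfin : {e : E | G.s e = v}.Finite) :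
      LeavittRel G (gen K (.vertex v)) (∑ e ∈ hfin.toFinset, gen K (.edge e) * gen K (.ghost e))

/-- Congruence modulo the (two-sided, `K`-stable) ideal of the free associative algebra generated
by the defining relations. In a non-unital ring the scalar multiples of the generating relations
have to be put in by hand to get an algebra ideal. -/
noncomputable def leavittCon (G : DirectedGraph V E) : RingCon (FreeAssoc K (LeavittGen V E)) :=
  ringConGen fun x y => ∃ (k : K) (a b : FreeAssoc K (LeavittGen V E)),
    LeavittRel K G a b ∧ x = k • a ∧ y = k • b

/-- The congruence is `K`-stable. -/
theorem leavittCon_smul (G : DirectedGraph V E) (k : K) {x y : FreeAssoc K (LeavittGen V E)}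
    (h : leavittCon K G x y) : leavittCon K G (k • x) (k • y) := by
  change RingConGen.Rel _ _ _ at h
  change RingConGen.Rel _ _ _
  induction h with
  | of x y h =>
    obtain ⟨l, a, b, hab, rfl, rfl⟩ := h
    exact .of _ _ ⟨k * l, a, b, hab, smul_smul _ _ _, smul_smul _ _ _⟩
  | refl x => exact .refl _
  | symm _ ih => exact .symm ih
  | trans _ _ ih₁ ih₂ => exact .trans ih₁ ih₂
  | add _ _ ih₁ ih₂ => rw [smul_add, smul_add]; exact .add ih₁ ih₂
  | mul _ h₂ ih₁ _ => rw [← smul_mul_assoc, ← smul_mul_assoc]; exact .mul ih₁ h₂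

/-- The Leavitt path algebra `L_K(E)`, a (generally non-unital) associative `K`-algebra: the free
associative algebra on vertices, edges and ghost edges modulo the defining relations. -/
def LeavittPathAlgebra (G : DirectedGraph V E) := (leavittCon K G).Quotient

end Relations

namespace LeavittPathAlgebra

variable {K : Type*} [Field K] {G : DirectedGraph V E}

noncomputable instance : NonUnitalRing (LeavittPathAlgebra K G) :=
  inferInstanceAs (NonUnitalRing (leavittCon K G).Quotient)

noncomputable instance : SMul K (LeavittPathAlgebra K G) where
  smul k := Quotient.map' (k • ·) fun _ _ h => leavittCon_smul K G k h

noncomputable instance : Module K (LeavittPathAlgebra K G) where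
  one_smul := Quotient.ind' fun _ => congrArg Quotient.mk'' (one_smul _ _)
  mul_smul _ _ := Quotient.ind' fun _ => congrArg Quotient.mk'' (mul_smul _ _ _)
  smul_zero _ := congrArg Quotient.mk'' (smul_zero _)
  smul_add _ := Quotient.ind₂' fun _ _ => congrArg Quotient.mk'' (smul_add _ _ _)
  add_smul _ _ := Quotient.ind' fun _ => congrArg Quotient.mk'' (add_smul _ _ _)
  zero_smul := Quotient.ind' fun _ => congrArg Quotient.mk'' (zero_smul _ _)

noncomputable instance : IsScalarTower K (LeavittPathAlgebra K G) (LeavittPathAlgebra K G) where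
  smul_assoc _ := Quotient.ind₂' fun _ _ => congrArg Quotient.mk'' (smul_mul_assoc _ _ _)

noncomputable instance : SMulCommClass K (LeavittPathAlgebra K G) (LeavittPathAlgebra K G) where
  smul_comm _ := Quotient.ind₂' fun _ _ => congrArg Quotient.mk'' (mul_smul_comm _ _ _).symm

variable (K G)

/-- The image in `L_K(E)` of a generator. -/
noncomputable def gen (x : LeavittGen V E) : LeavittPathAlgebra K G :=
  RingCon.toQuotient (c := leavittCon K G) (FreeAssoc.gen K x)

/-- The vertex `v` as an element of `L_K(E)`. -/
noncomputable def vertex (v : V) : LeavittPathAlgebra K G := gen K G (.vertex v)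

/-- The edge `e` as an element of `L_K(E)`. -/
noncomputable def edge (e : E) : LeavittPathAlgebra K G := gen K G (.edge e)

/-- The path `e₁ e₂ ⋯ eₙ` (with `n ≥ 1`) as an element of `L_K(E)`; the first argument is its first
edge, the second the list of the remaining ones. -/
noncomputable def path : E → List E → LeavittPathAlgebra K G
  | e, [] => edge K G e
  | e, f :: l => edge K G e * path f l

end LeavittPathAlgebra

end DirectedGraph

/-- An element `x` of a possibly non-unital ring is nilpotent: `x ^ (n + 1) = 0` for some `n : ℕ`,
the power being written as `x * (x * (⋯ * x))`. -/
def IsNonUnitalNilpotent {A : Type*} [NonUnitalRing A] (x : A) : Prop :=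
  ∃ n : ℕ, (fun y => x * y)^[n] x = 0

/-! The kernel `I` of `π` is a two-sided ideal, and it is closed under scalars because sums of
vertices are local units. If it is nonzero, it is shown to contain `p(c)` for a cycle `c` without
exits and a nonzero polynomial `p`; the grading then forbids this.

Reduction to a cycle. Multiplying by edges on the right removes ghost edges, so `I` contains the
value of a nonzero formal combination of real paths (`exists_evalFrom_mem_of_ne_zero`). Multiplying
by ghost edges on the left makes all paths closed, with nonzero constant term (`exists_isReduced`).
Among such combinations take one with fewest terms: conjugation `e* y e` cannot kill any term, so no
path in it has an exit (`IsReduced.exists_hasNoExit`). Closed paths without exits at a vertex are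
powers of one cycle, and as `I` contains no vertex, this gives `p(c)` (`exists_polynomial_mem`).
Combinations stay formal throughout, so linear independence of paths is never needed.

Contradiction. As `π` is not assumed linear, the coefficients of `p` have no meaning in `A`; only
integer polynomials carry over, and `X + 1` suffices. For `x = π(c)` homogeneous of nonzero degree,
`z + xz = 0` forces `z = 0`, and `w + xw = x` forces `x` nilpotent, by comparing homogeneous
components. Write `p = (X + 1)^m q` with `q(-1) ≠ 0`. Injectivity of `1 + x` puts `q(c)` in the
kernel, and a Bézout relation between `q` and `X + 1` then solves `w + xw = x`. -/

namespace DirectedGraph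

variable {V E : Type*}

/-- The list `l` of edges is a path from `v` to `w`. -/
def IsPath (G : DirectedGraph V E) : V → List E → V → Prop
  | v, [], w => v = w
  | v, e :: l, w => G.s e = v ∧ G.IsPath (G.r e) l w

section IsPath

variable {G : DirectedGraph V E}

@[simp] theorem isPath_nil {v w : V} : G.IsPath v [] w ↔ v = w := Iff.rfl

@[simp] theorem isPath_cons {v w : V} {e : E} {l : List E} :
    G.IsPath v (e :: l) w ↔ G.s e = v ∧ G.IsPath (G.r e) l w := Iff.rfl

theorem isPath_append {v w : V} {l m : List E} :
    G.IsPath v (l ++ m) w ↔ ∃ u, G.IsPath v l u ∧ G.IsPath u m w := by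
  induction l generalizing v with
  | nil => simp
  | cons e l ih => simp [ih, and_assoc]

theorem IsPath.unique {v w w' : V} {l : List E} (h : G.IsPath v l w) (h' : G.IsPath v l w') :
    w = w' := by
  induction l generalizing v with
  | nil => exact h.symm.trans h'
  | cons e l ih => exact ih h.2 h'.2

end IsPath

/-! ### Monomials `α β*` and local units -/

namespace LeavittPathAlgebra

variable {K : Type*} [Field K] {G : DirectedGraph V E}

theorem toQuotient_eq_of_rel {a b : FreeAssoc K (LeavittGen V E)} (h : LeavittRel K G a b) :
    (RingCon.toQuotient (c := leavittCon K G) a : LeavittPathAlgebra K G) =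
      RingCon.toQuotient (c := leavittCon K G) b :=
  (RingCon.eq _).2 (RingConGen.Rel.of _ _ ⟨1, a, b, h, (one_smul _ _).symm, (one_smul _ _).symm⟩)

variable (K G) in
/-- The ghost edge `e*` as an element of `L_K(E)`. -/
noncomputable def ghost (e : E) : LeavittPathAlgebra K G := gen K G (.ghost e)

theorem vertex_mul_self (v : V) : vertex K G v * vertex K G v = vertex K G v :=
  toQuotient_eq_of_rel (.vertex_idem v)

theorem vertex_mul_vertex_of_ne {v w : V} (h : v ≠ w) : vertex K G v * vertex K G w = 0 :=
  toQuotient_eq_of_rel (.vertex_orth v w h)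

theorem vertex_mul_edge (e : E) : vertex K G (G.s e) * edge K G e = edge K G e :=
  toQuotient_eq_of_rel (.source_edge e)

theorem edge_mul_vertex (e : E) : edge K G e * vertex K G (G.r e) = edge K G e :=
  toQuotient_eq_of_rel (.edge_range e)

theorem vertex_mul_ghost (e : E) : vertex K G (G.r e) * ghost K G e = ghost K G e :=
  toQuotient_eq_of_rel (.range_ghost e)

theorem ghost_mul_vertex (e : E) : ghost K G e * vertex K G (G.s e) = ghost K G e :=
  toQuotient_eq_of_rel (.ghost_source e)

theorem ghost_mul_edge_self (e : E) : ghost K G e * edge K G e = vertex K G (G.r e) :=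
  toQuotient_eq_of_rel (.ghost_edge_self e)

theorem ghost_mul_edge_of_ne {e f : E} (h : e ≠ f) : ghost K G e * edge K G f = 0 :=
  toQuotient_eq_of_rel (.ghost_edge_ne e f h)

theorem vertex_eq_sum {v : V} (hne : {e : E | G.s e = v}.Nonempty)
    (hfin : {e : E | G.s e = v}.Finite) :
    vertex K G v = ∑ e ∈ hfin.toFinset, edge K G e * ghost K G e := by
  refine (toQuotient_eq_of_rel (.ck2 v hne hfin)).trans ?_
  exact map_sum (⟨⟨RingCon.toQuotient (c := leavittCon K G), rfl⟩, fun _ _ => rfl⟩ :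
    FreeAssoc K (LeavittGen V E) →+ LeavittPathAlgebra K G) _ _

theorem vertex_mul_edge_of_ne {v : V} {e : E} (h : G.s e ≠ v) :
    vertex K G v * edge K G e = 0 := by
  rw [← vertex_mul_edge, ← mul_assoc, vertex_mul_vertex_of_ne h.symm, zero_mul]

theorem vertex_mul_ghost_of_ne {v : V} {e : E} (h : G.r e ≠ v) :
    vertex K G v * ghost K G e = 0 := by
  rw [← vertex_mul_ghost, ← mul_assoc, vertex_mul_vertex_of_ne h.symm, zero_mul]

theorem ghost_mul_vertex_of_ne {v : V} {e : E} (h : G.s e ≠ v) :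
    ghost K G e * vertex K G v = 0 := by
  rw [← ghost_mul_vertex, mul_assoc, vertex_mul_vertex_of_ne h, mul_zero]

variable (K G) in
/-- The element `v e₁ ⋯ eₙ` of `L_K(E)`, which is zero unless `e₁ ⋯ eₙ` is a path starting
at `v`. -/
noncomputable def pathFrom : V → List E → LeavittPathAlgebra K G
  | v, [] => vertex K G v
  | v, e :: l => vertex K G v * (edge K G e * pathFrom (G.r e) l)

variable (K G) in
/-- The element `eₙ* ⋯ e₁* v` of `L_K(E)`, the adjoint of `pathFrom`. -/
noncomputable def ghostTo : V → List E → LeavittPathAlgebra K G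
  | v, [] => vertex K G v
  | v, e :: l => ghostTo (G.r e) l * (ghost K G e * vertex K G v)

theorem pathFrom_cons {v : V} {e : E} (h : G.s e = v) (l : List E) :
    pathFrom K G v (e :: l) = edge K G e * pathFrom K G (G.r e) l := by
  rw [pathFrom, ← mul_assoc, ← h, vertex_mul_edge]

theorem pathFrom_cons_of_ne {v : V} {e : E} (h : G.s e ≠ v) (l : List E) :
    pathFrom K G v (e :: l) = 0 := by
  rw [pathFrom, ← mul_assoc, vertex_mul_edge_of_ne h, zero_mul]

theorem pathFrom_singleton {v : V} {e : E} (h : G.s e = v) :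
    pathFrom K G v [e] = edge K G e := by
  rw [pathFrom_cons h, pathFrom, edge_mul_vertex]

theorem vertex_mul_pathFrom (v : V) (l : List E) :
    vertex K G v * pathFrom K G v l = pathFrom K G v l := by
  cases l <;> simp only [pathFrom, ← mul_assoc, vertex_mul_self]

theorem vertex_mul_pathFrom_of_ne {v w : V} (h : w ≠ v) (l : List E) :
    vertex K G w * pathFrom K G v l = 0 := by
  rw [← vertex_mul_pathFrom, ← mul_assoc, vertex_mul_vertex_of_ne h, zero_mul]

theorem ghostTo_mul_vertex (v : V) (l : List E) :
    ghostTo K G v l * vertex K G v = ghostTo K G v l := by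
  cases l <;> simp only [ghostTo, mul_assoc, vertex_mul_self]

theorem ghostTo_mul_vertex_of_ne {v w : V} (h : v ≠ w) (l : List E) :
    ghostTo K G v l * vertex K G w = 0 := by
  rw [← ghostTo_mul_vertex, mul_assoc, vertex_mul_vertex_of_ne h, mul_zero]

theorem pathFrom_mul_pathFrom {v w : V} {l : List E} (h : G.IsPath v l w) (m : List E) :
    pathFrom K G v l * pathFrom K G w m = pathFrom K G v (l ++ m) := by
  induction l generalizing v with
  | nil => obtain rfl : v = w := h; exact vertex_mul_pathFrom _ _
  | cons e l ih =>
    rw [pathFrom_cons h.1, mul_assoc, ih h.2, List.cons_append, pathFrom_cons h.1]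

theorem pathFrom_mul_vertex {v w : V} {l : List E} (h : G.IsPath v l w) :
    pathFrom K G v l * vertex K G w = pathFrom K G v l := by
  simpa [pathFrom] using pathFrom_mul_pathFrom (K := K) h []

theorem pathFrom_mul_vertex_of_ne {v w u : V} {l : List E} (h : G.IsPath v l w) (hne : w ≠ u) :
    pathFrom K G v l * vertex K G u = 0 := by
  rw [← pathFrom_mul_vertex h, mul_assoc, vertex_mul_vertex_of_ne hne, mul_zero]

theorem pathFrom_mul_edge {v w : V} {l : List E} (h : G.IsPath v l w) {e : E} (he : G.s e = w) :
    pathFrom K G v l * edge K G e = pathFrom K G v (l ++ [e]) := by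
  rw [← pathFrom_mul_pathFrom h, pathFrom_singleton he]

theorem exists_isPath_or_pathFrom_eq_zero (v : V) (l : List E) :
    (∃ w, G.IsPath v l w) ∨ pathFrom K G v l = 0 := by
  induction l generalizing v with
  | nil => exact .inl ⟨v, rfl⟩
  | cons e l ih =>
    by_cases h : G.s e = v
    · rcases ih (G.r e) with ⟨w, hw⟩ | h0
      · exact .inl ⟨w, h, hw⟩
      · exact .inr (by rw [pathFrom_cons h, h0, mul_zero])
    · exact .inr (pathFrom_cons_of_ne h l)

theorem path_eq_pathFrom {e : E} {l : List E}
    (h : (e :: l).IsChain (fun e f => G.r e = G.s f)) :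
    path K G e l = pathFrom K G (G.s e) (e :: l) := by
  induction l generalizing e with
  | nil => rw [pathFrom_singleton rfl, path]
  | cons f l ih =>
    rw [List.isChain_cons_cons] at h
    rw [path, ih h.2, pathFrom_cons rfl (f :: l), h.1]

/-- The span is stable under right multiplication by generators: in `α β* f` the edge `f` either
meets a ghost edge, and `e* f` is a vertex or zero, or `β` is empty and `f` extends `α`. Since it
contains the generators, it contains every word. -/
theorem span_pathFrom_mul_ghostTo :
    Submodule.span K {x : LeavittPathAlgebra K G |
      ∃ v α w β, x = pathFrom K G v α * ghostTo K G w β} = ⊤ := by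
  set T := Submodule.span K {x : LeavittPathAlgebra K G |
      ∃ v α w β, x = pathFrom K G v α * ghostTo K G w β} with hT
  have mem (v α w β) : pathFrom K G v α * ghostTo K G w β ∈ T :=
    Submodule.subset_span ⟨v, α, w, β, rfl⟩
  have hgen (t : LeavittPathAlgebra K G) (ht : t ∈ T) (g : LeavittGen V E) :
      t * gen K G g ∈ T := by
    induction ht using Submodule.span_induction with
    | zero => simp
    | add x y _ _ hx hy => rw [add_mul]; exact T.add_mem hx hy
    | smul k x _ hx => rw [smul_mul_assoc]; exact T.smul_mem _ hx
    | mem x hx =>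
      obtain ⟨v, α, w, β, rfl⟩ := hx
      rw [mul_assoc]
      cases g with
      | vertex u =>
        change _ * (_ * vertex K G u) ∈ T
        by_cases h : w = u
        · rw [← h, ghostTo_mul_vertex]; exact mem _ _ _ _
        · rw [ghostTo_mul_vertex_of_ne h, mul_zero]; exact T.zero_mem
      | ghost g =>
        change _ * (_ * ghost K G g) ∈ T
        rw [← ghostTo_mul_vertex, mul_assoc]
        by_cases h : G.r g = w
        · rw [← h, vertex_mul_ghost, ← ghost_mul_vertex]
          exact mem _ _ (G.s g) (g :: β)
        · rw [vertex_mul_ghost_of_ne h, mul_zero, mul_zero]; exact T.zero_mem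
      | edge f =>
        change _ * (_ * edge K G f) ∈ T
        rw [← ghostTo_mul_vertex, mul_assoc]
        by_cases h : G.s f = w
        · subst h
          rw [vertex_mul_edge]
          cases β with
          | nil =>
            rw [ghostTo, vertex_mul_edge]
            rcases exists_isPath_or_pathFrom_eq_zero (K := K) (G := G) v α with ⟨u, hu⟩ | h0
            · by_cases h : G.s f = u
              · rw [pathFrom_mul_edge hu h, ← pathFrom_mul_vertex (w := G.r f)
                  (isPath_append.2 ⟨u, hu, isPath_cons.2 ⟨h, isPath_nil.2 rfl⟩⟩)]
                exact mem _ _ _ []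
              · rw [← pathFrom_mul_vertex hu, mul_assoc, vertex_mul_edge_of_ne h, mul_zero]
                exact T.zero_mem
            · rw [h0, zero_mul]; exact T.zero_mem
          | cons e β =>
            rw [ghostTo, mul_assoc, mul_assoc, vertex_mul_edge]
            by_cases h : e = f
            · rw [h, ghost_mul_edge_self, ghostTo_mul_vertex]; exact mem _ _ _ _
            · rw [ghost_mul_edge_of_ne h, mul_zero, mul_zero]; exact T.zero_mem
        · rw [vertex_mul_edge_of_ne h, mul_zero, mul_zero]; exact T.zero_mem
  have hvertex (v : V) : vertex K G v ∈ T := by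
    rw [← vertex_mul_self]; exact mem v [] v []
  have hgen' (g : LeavittGen V E) : gen K G g ∈ T := by
    cases g with
    | vertex v => exact hvertex v
    | edge e => have := hgen _ (hvertex (G.s e)) (.edge e); rwa [← edge, vertex_mul_edge] at this
    | ghost e =>
      have := hgen _ (hvertex (G.r e)) (.ghost e); rwa [← ghost, vertex_mul_ghost] at this
  let q : FreeSemigroup (LeavittGen V E) → LeavittPathAlgebra K G := fun u =>
    RingCon.toQuotient (c := leavittCon K G) (MonoidAlgebra.single u 1)
  have hq (u u') : q (u * u') = q u * q u' := by
    change _ = RingCon.toQuotient (c := leavittCon K G)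
      (MonoidAlgebra.single u 1 * MonoidAlgebra.single u' 1)
    rw [MonoidAlgebra.single_mul_single, one_mul]
  have hmul (u) : ∀ t ∈ T, t * q u ∈ T := by
    induction u using FreeSemigroup.recOnMul with
    | ih1 g => exact fun t ht => hgen t ht g
    | ih2 g u _ ih => exact fun t ht => by rw [hq, ← mul_assoc]; exact ih _ (hgen t ht g)
  have hword (u) : q u ∈ T := by
    induction u using FreeSemigroup.recOnMul with
    | ih1 g => exact hgen' g
    | ih2 g u _ _ => rw [hq]; exact hmul _ _ (hgen' g)
  rw [eq_top_iff]
  rintro x -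
  induction x using Quotient.inductionOn' with | h a =>
  induction a using MonoidAlgebra.induction_linear with
  | zero => exact T.zero_mem
  | add a b ha hb => exact T.add_mem ha hb
  | single u k =>
    have : MonoidAlgebra.single u k = k • (MonoidAlgebra.single u 1 :
        FreeAssoc K (LeavittGen V E)) := by simp
    rw [this]
    exact T.smul_mem k (hword u)

/-- Sums of vertices over large finite sets are local units. -/
theorem exists_local_unit (x : LeavittPathAlgebra K G) :
    ∃ S : Finset V, ∀ S', S ⊆ S' →
      (∑ v ∈ S', vertex K G v) * x = x ∧ x * ∑ v ∈ S', vertex K G v = x := by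
  classical
  have hx : x ∈ (⊤ : Submodule K (LeavittPathAlgebra K G)) := trivial
  rw [← span_pathFrom_mul_ghostTo] at hx
  induction hx using Submodule.span_induction with
  | zero => exact ⟨∅, by simp⟩
  | add x y _ _ hx hy =>
    obtain ⟨S, hS⟩ := hx
    obtain ⟨S', hS'⟩ := hy
    refine ⟨S ∪ S', fun U hU => ?_⟩
    have h1 := hS U (Finset.union_subset_left hU)
    have h2 := hS' U (Finset.union_subset_right hU)
    rw [mul_add, add_mul, h1.1, h1.2, h2.1, h2.2]
    exact ⟨rfl, rfl⟩
  | smul k x _ hx =>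
    obtain ⟨S, hS⟩ := hx
    refine ⟨S, fun U hU => ?_⟩
    rw [mul_smul_comm, smul_mul_assoc, (hS U hU).1, (hS U hU).2]
    exact ⟨rfl, rfl⟩
  | mem x hx =>
    obtain ⟨v, α, w, β, rfl⟩ := hx
    refine ⟨{v, w}, fun U hU => ⟨?_, ?_⟩⟩
    · rw [← mul_assoc, Finset.sum_mul, Finset.sum_eq_single v, vertex_mul_pathFrom]
      · exact fun u _ hu => vertex_mul_pathFrom_of_ne hu _
      · exact fun h => absurd (hU (by simp)) h
    · rw [mul_assoc, Finset.mul_sum, Finset.sum_eq_single w, ghostTo_mul_vertex]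
      · exact fun u _ hu => ghostTo_mul_vertex_of_ne hu.symm _
      · exact fun h => absurd (hU (by simp)) h

theorem eq_zero_of_vertex_mul_mul_vertex {x : LeavittPathAlgebra K G}
    (h : ∀ v w, vertex K G v * x * vertex K G w = 0) : x = 0 := by
  obtain ⟨S, hS⟩ := exists_local_unit x
  obtain ⟨h1, h2⟩ := hS S subset_rfl
  rw [← h2, ← h1, Finset.sum_mul, Finset.sum_mul]
  simp [Finset.mul_sum, h]

end LeavittPathAlgebra

end DirectedGraph
-- Eliminating ghost edges from an ideal
namespace DirectedGraph

variable {V E : Type*}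

namespace LeavittPathAlgebra

variable {K : Type*} [Field K] {G : DirectedGraph V E}

variable (K G) in
/-- The linear combination in `L_K(E)` of paths starting at `v` with the given coefficients. -/
noncomputable def evalFrom (v : V) : (List E →₀ K) →ₗ[K] LeavittPathAlgebra K G :=
  Finsupp.linearCombination K (pathFrom K G v)

variable (K G) in
/-- The span of the monomials `α β*`, with `α` starting at `v` and `β` starting at `w`, where `β`
has length at most `n`. -/
noncomputable def ghostFiltration (n : ℕ) (v w : V) : Submodule K (LeavittPathAlgebra K G) :=
  Submodule.span K {x | ∃ α β, β.length ≤ n ∧ x = pathFrom K G v α * ghostTo K G w β}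

variable (K G) in
/-- The span of the real paths from `v` to `w`. -/
noncomputable def realPart (v w : V) : Submodule K (LeavittPathAlgebra K G) :=
  (Finsupp.supported K K {l : List E | G.IsPath v l w}).map (evalFrom K G v)

theorem pathFrom_mem_realPart {v w : V} {l : List E} (h : G.IsPath v l w) :
    pathFrom K G v l ∈ realPart K G v w :=
  ⟨Finsupp.single l 1, Finsupp.single_mem_supported K 1 h, by simp [evalFrom]⟩

theorem pathFrom_mul_vertex_mem_realPart (v w : V) (l : List E) :
    pathFrom K G v l * vertex K G w ∈ realPart K G v w := by
  rcases exists_isPath_or_pathFrom_eq_zero (K := K) (G := G) v l with ⟨u, hu⟩ | h0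
  · by_cases h : u = w
    · subst h
      rw [pathFrom_mul_vertex hu]
      exact pathFrom_mem_realPart hu
    · rw [pathFrom_mul_vertex_of_ne hu h]; exact zero_mem _
  · rw [h0, zero_mul]; exact zero_mem _

theorem realPart_eq_span (v w : V) :
    realPart K G v w = Submodule.span K (pathFrom K G v '' {l | G.IsPath v l w}) :=
  (Finsupp.span_image_eq_map_linearCombination K _).symm

theorem ghostFiltration_mono {m n : ℕ} (h : m ≤ n) (v w : V) :
    ghostFiltration K G m v w ≤ ghostFiltration K G n v w := by
  refine Submodule.span_mono ?_
  rintro _ ⟨α, β, hβ, rfl⟩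
  exact ⟨α, β, hβ.trans h, rfl⟩

theorem realPart_le_ghostFiltration (n : ℕ) (v w : V) :
    realPart K G v w ≤ ghostFiltration K G n v w := by
  rw [realPart_eq_span, Submodule.span_le]
  rintro _ ⟨l, hl, rfl⟩
  exact Submodule.subset_span ⟨l, [], Nat.zero_le _, (pathFrom_mul_vertex hl).symm⟩

theorem ghostFiltration_zero_le (v w : V) : ghostFiltration K G 0 v w ≤ realPart K G v w := by
  rw [ghostFiltration, Submodule.span_le]
  rintro _ ⟨α, β, hβ, rfl⟩
  rw [List.eq_nil_of_length_eq_zero (Nat.le_zero.1 hβ)]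
  exact pathFrom_mul_vertex_mem_realPart ..

theorem mul_vertex_of_mem_ghostFiltration {n : ℕ} {v w : V} {x : LeavittPathAlgebra K G}
    (hx : x ∈ ghostFiltration K G n v w) : x * vertex K G w = x := by
  induction hx using Submodule.span_induction with
  | zero => simp
  | add x y _ _ hx hy => rw [add_mul, hx, hy]
  | smul k x _ hx => rw [smul_mul_assoc, hx]
  | mem x hx =>
    obtain ⟨α, β, _, rfl⟩ := hx
    rw [mul_assoc, ghostTo_mul_vertex]

/-- The first edge `e` of `β` contributes the rightmost factor `e*` of `α β*`; grouping monomials by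
it lowers the ghost length by one. -/
theorem exists_of_mem_ghostFiltration_succ {n : ℕ} {v w : V} {x : LeavittPathAlgebra K G}
    (hx : x ∈ ghostFiltration K G (n + 1) v w) :
    ∃ y ∈ realPart K G v w, ∃ z : E →₀ LeavittPathAlgebra K G,
      (∀ e ∈ z.support, G.s e = w) ∧ (∀ e, z e ∈ ghostFiltration K G n v (G.r e)) ∧
      x = y + z.sum fun e a => a * ghost K G e := by
  classical
  induction hx using Submodule.span_induction with
  | zero => exact ⟨0, zero_mem _, 0, by simp, by simp, by simp⟩
  | add x x' _ _ hx hx' =>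
    obtain ⟨y, hy, z, hz, hzn, rfl⟩ := hx
    obtain ⟨y', hy', z', hz', hzn', rfl⟩ := hx'
    refine ⟨y + y', add_mem hy hy', z + z', fun e he => ?_, fun e => add_mem (hzn e) (hzn' e), ?_⟩
    · exact (Finset.mem_union.1 (Finsupp.support_add he)).elim (hz e) (hz' e)
    · rw [Finsupp.sum_add_index' (by simp) (by simp [add_mul])]
      abel
  | smul k x _ hx =>
    obtain ⟨y, hy, z, hz, hzn, rfl⟩ := hx
    refine ⟨k • y, Submodule.smul_mem _ _ hy, k • z, fun e he => hz e (Finsupp.support_smul he),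
      fun e => Submodule.smul_mem _ _ (hzn e), ?_⟩
    rw [Finsupp.sum_smul_index' (by simp), smul_add, Finsupp.smul_sum]
    simp only [smul_mul_assoc]
  | mem x hx =>
    obtain ⟨α, β, hβ, rfl⟩ := hx
    cases β with
    | nil => exact ⟨_, pathFrom_mul_vertex_mem_realPart v w α, 0, by simp, by simp, by simp [ghostTo]⟩
    | cons e β =>
      by_cases h : G.s e = w
      · refine ⟨0, zero_mem _, Finsupp.single e (pathFrom K G v α * ghostTo K G (G.r e) β),
          fun f hf => ?_, fun f => ?_, ?_⟩
        · rw [Finset.mem_singleton.1 (Finsupp.support_single_subset hf), h]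
        · by_cases hf : e = f
          · subst hf
            rw [Finsupp.single_eq_same]
            exact Submodule.subset_span ⟨α, β, by simpa using hβ, rfl⟩
          · rw [Finsupp.single_eq_of_ne (Ne.symm hf)]; exact zero_mem _
        · rw [Finsupp.sum_single_index (by simp), zero_add, ghostTo, ← h, ghost_mul_vertex,
            mul_assoc]
      · refine ⟨0, zero_mem _, 0, by simp, by simp, ?_⟩
        rw [ghostTo, ghost_mul_vertex_of_ne h]
        simp

theorem evalFrom_mul_edge {v w : V} {y : List E →₀ K}
    (hy : y ∈ Finsupp.supported K K {l : List E | G.IsPath v l w}) {f : E} (hf : G.s f = w) :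
    evalFrom K G v y * edge K G f = evalFrom K G v (y.mapDomain (· ++ [f])) := by
  rw [evalFrom, Finsupp.linearCombination_mapDomain, Finsupp.linearCombination_apply,
    Finsupp.linearCombination_apply, Finsupp.sum, Finsupp.sum, Finset.sum_mul]
  refine Finset.sum_congr rfl fun l hl => ?_
  rw [smul_mul_assoc, pathFrom_mul_edge (hy hl) hf, Function.comp_apply]

theorem mapDomain_append_mem_supported {v w : V} {y : List E →₀ K}
    (hy : y ∈ Finsupp.supported K K {l : List E | G.IsPath v l w}) {f : E} (hf : G.s f = w) :
    y.mapDomain (· ++ [f]) ∈ Finsupp.supported K K {l : List E | G.IsPath v l (G.r f)} := by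
  classical
  intro l hl
  obtain ⟨m, hm, rfl⟩ := Finset.mem_image.1 (Finsupp.mapDomain_support hl)
  exact isPath_append.2 ⟨w, hy hm, isPath_cons.2 ⟨hf, isPath_nil.2 rfl⟩⟩

variable {I : Submodule K (LeavittPathAlgebra K G)}

/-- For `x = y + ∑ z_e e*` with `y` real, `x f = y f + z_f` has shorter ghost parts and lies in `I`,
so it vanishes by induction. It remains to recover `x` from the products `x f`. The hypothesis
`hreal` is about formal combinations, so it yields vanishing coefficients and not only vanishing
values. -/
theorem eq_zero_of_mem_ghostFiltration (hmul : ∀ x ∈ I, ∀ a, x * a ∈ I)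
    (hreal : ∀ v w, ∀ y ∈ Finsupp.supported K K {l : List E | G.IsPath v l w},
      evalFrom K G v y ∈ I → y = 0) (n : ℕ) {v w : V} {x : LeavittPathAlgebra K G}
    (hx : x ∈ ghostFiltration K G n v w) (hxI : x ∈ I) : x = 0 := by
  classical
  have hzero {v w : V} {x : LeavittPathAlgebra K G} (hx : x ∈ realPart K G v w) (hxI : x ∈ I) :
      x = 0 := by
    obtain ⟨y, hy, rfl⟩ := hx
    rw [hreal v w y hy hxI, map_zero]
  induction n generalizing v w x with
  | zero => exact hzero (ghostFiltration_zero_le v w hx) hxI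
  | succ n ih =>
    obtain ⟨y, hy, z, hz, hzn, hxyz⟩ := exists_of_mem_ghostFiltration_succ hx
    have hxf (f : E) : x * edge K G f = y * edge K G f + z f := by
      rw [hxyz, add_mul, Finsupp.sum, Finset.sum_mul, Finset.sum_eq_single f, mul_assoc,
        ghost_mul_edge_self, mul_vertex_of_mem_ghostFiltration (hzn f)]
      · intro e _ hef
        rw [mul_assoc, ghost_mul_edge_of_ne hef, mul_zero]
      · intro hf
        rw [Finsupp.notMem_support_iff.1 hf, zero_mul, zero_mul]
    obtain ⟨η, hη, hηy⟩ := hy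
    have hyf {f : E} (hf : G.s f = w) : y * edge K G f ∈ realPart K G v (G.r f) := by
      rw [← hηy, evalFrom_mul_edge hη hf]
      exact ⟨_, mapDomain_append_mem_supported hη hf, rfl⟩
    have hxf0 {f : E} (hf : G.s f = w) : x * edge K G f = 0 := by
      refine ih (w := G.r f) (v := v) ?_ (hmul x hxI _)
      rw [hxf]
      exact add_mem (realPart_le_ghostFiltration n _ _ (hyf hf)) (hzn f)
    -- At a regular vertex `x = ∑ x f f* = 0`; at a sink there is no `z`, so `x` is real.
    by_cases hfin : {e : E | G.s e = w}.Finite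
    · by_cases hne : {e : E | G.s e = w}.Nonempty
      · rw [← mul_vertex_of_mem_ghostFiltration hx, vertex_eq_sum hne hfin, Finset.mul_sum]
        refine Finset.sum_eq_zero fun e he => ?_
        rw [← mul_assoc, hxf0 (by simpa using he), zero_mul]
      · have hz0 : z = 0 := by
          rw [← Finsupp.support_eq_empty, Finset.eq_empty_iff_forall_notMem]
          exact fun e he => hne ⟨e, hz e he⟩
        refine hzero (v := v) (w := w) ⟨η, hη, ?_⟩ hxI
        rw [hxyz, hz0, Finsupp.sum_zero_index, add_zero, hηy]
    -- At an infinite emitter some `f` has `z_f = 0`, so `y f = 0`. Appending `f` is injective on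
    -- paths, hence `y = 0`, and then every `z_e = x e` vanishes.
    · obtain ⟨f, hf, hfz⟩ := Set.Infinite.exists_notMem_finset hfin z.support
      have h0 := hxf f
      rw [Finsupp.notMem_support_iff.1 hfz, hxf0 hf, add_zero, ← hηy, evalFrom_mul_edge hη hf] at h0
      have h1 := hreal v _ _ (mapDomain_append_mem_supported hη hf) (h0 ▸ zero_mem I)
      have h2 : η = 0 := Finsupp.mapDomain_injective (List.append_left_injective [f])
        (h1.trans Finsupp.mapDomain_zero.symm)
      have hy0 : y = 0 := by rw [← hηy, h2, map_zero]
      have hz0 : z = 0 := by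
        rw [← Finsupp.support_eq_empty, Finset.eq_empty_iff_forall_notMem]
        intro e he
        have := hxf e
        rw [hxf0 (hz e he), hy0, zero_mul, zero_add] at this
        exact Finsupp.mem_support_iff.1 he this.symm
      rw [hxyz, hy0, hz0, Finsupp.sum_zero_index, add_zero]

theorem exists_mem_ghostFiltration (v w : V) (x : LeavittPathAlgebra K G) :
    ∃ n, vertex K G v * x * vertex K G w ∈ ghostFiltration K G n v w := by
  have hx : x ∈ (⊤ : Submodule K (LeavittPathAlgebra K G)) := trivial
  rw [← span_pathFrom_mul_ghostTo] at hx
  induction hx using Submodule.span_induction with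
  | zero => exact ⟨0, by simp⟩
  | add x y _ _ hx hy =>
    obtain ⟨m, hm⟩ := hx
    obtain ⟨n, hn⟩ := hy
    refine ⟨max m n, ?_⟩
    rw [mul_add, add_mul]
    exact add_mem (ghostFiltration_mono (le_max_left m n) _ _ hm)
      (ghostFiltration_mono (le_max_right m n) _ _ hn)
  | smul k x _ hx =>
    obtain ⟨n, hn⟩ := hx
    refine ⟨n, ?_⟩
    rw [mul_smul_comm, smul_mul_assoc]
    exact Submodule.smul_mem _ _ hn
  | mem x hx =>
    obtain ⟨v', α, w', β, rfl⟩ := hx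
    refine ⟨β.length, ?_⟩
    rw [← mul_assoc, mul_assoc]
    by_cases hv : v = v'
    · by_cases hw : w' = w
      · subst hv hw
        rw [vertex_mul_pathFrom, ghostTo_mul_vertex]
        exact Submodule.subset_span ⟨α, β, le_rfl, rfl⟩
      · rw [ghostTo_mul_vertex_of_ne hw, mul_zero]; exact zero_mem _
    · rw [vertex_mul_pathFrom_of_ne hv, zero_mul]; exact zero_mem _

/-- A nonzero two-sided ideal of `L_K(E)` contains the image of a nonzero formal linear combination
of real paths with a common source and a common range. -/
theorem exists_evalFrom_mem_of_ne_zero (hleft : ∀ x ∈ I, ∀ a, a * x ∈ I)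
    (hright : ∀ x ∈ I, ∀ a, x * a ∈ I) {x : LeavittPathAlgebra K G} (hxI : x ∈ I) (hx : x ≠ 0) :
    ∃ v w, ∃ y ∈ Finsupp.supported K K {l : List E | G.IsPath v l w},
      evalFrom K G v y ∈ I ∧ y ≠ 0 := by
  by_contra! h
  refine hx (eq_zero_of_vertex_mul_mul_vertex fun v w => ?_)
  obtain ⟨n, hn⟩ := exists_mem_ghostFiltration v w x
  exact eq_zero_of_mem_ghostFiltration hright h n hn (hright _ (hleft x hxI _) _)

end LeavittPathAlgebra

end DirectedGraph
-- From real paths to a polynomial in a cycle without exits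
theorem List.exists_eq_append_of_not_nodup {α : Type*} {l : List α} (h : ¬ l.Nodup) :
    ∃ p a q r, l = p ++ a :: (q ++ a :: r) := by
  induction l with
  | nil => exact absurd List.nodup_nil h
  | cons a l ih =>
    by_cases ha : a ∈ l
    · obtain ⟨q, r, rfl⟩ := List.append_of_mem ha
      exact ⟨[], a, q, r, rfl⟩
    · obtain ⟨p, b, q, r, rfl⟩ := ih fun hl => h (List.nodup_cons.2 ⟨ha, hl⟩)
      exact ⟨a :: p, b, q, r, rfl⟩

namespace DirectedGraph

variable {V E : Type*} {G : DirectedGraph V E}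

theorem IsPath.isChain {v w : V} {l : List E} (h : G.IsPath v l w) :
    l.IsChain (fun e f => G.r e = G.s f) := by
  induction l generalizing v with
  | nil => exact List.isChain_nil
  | cons e l ih =>
    cases l with
    | nil => exact List.isChain_singleton _
    | cons f l => exact List.isChain_cons_cons.2 ⟨h.2.1.symm, ih h.2⟩

theorem IsPath.range_getLast {v w : V} {l : List E} (h : G.IsPath v l w) (hl : l ≠ []) :
    G.r (l.getLast hl) = w := by
  induction l generalizing v with
  | nil => exact absurd rfl hl
  | cons e l ih =>
    cases l with
    | nil => exact h.2
    | cons f l => rw [List.getLast_cons (List.cons_ne_nil _ _)]; exact ih h.2 _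

variable (G) in
/-- Every edge of `l` is the only edge with its source. -/
def HasNoExit (l : List E) : Prop := ∀ e ∈ l, ∀ f, G.s f = G.s e → f = e

theorem HasNoExit.not_isExit {l : List E} (h : G.HasNoExit l) : ¬ ∃ f, G.IsExit f l :=
  fun ⟨f, e, he, hs, hne⟩ => hne (h e he f hs)

theorem HasNoExit.exists_eq_append {v w w' : V} {c l : List E} (hc : G.HasNoExit c)
    (hcp : G.IsPath v c w) (hlp : G.IsPath v l w') (hlen : c.length ≤ l.length) :
    ∃ m, l = c ++ m := by
  induction c generalizing v l with
  | nil => exact ⟨l, rfl⟩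
  | cons a c ih =>
    cases l with
    | nil => simp at hlen
    | cons b l =>
      obtain rfl : b = a := hc a (by simp) b (hlp.1.trans hcp.1.symm)
      obtain ⟨m, rfl⟩ := ih (fun e he => hc e (by simp [he])) hcp.2 hlp.2 (by simpa using hlen)
      exact ⟨m, rfl⟩

/-- If some nonempty closed path at `w` has no exit, then one of them is a cycle, of which all the
others are powers. -/
theorem exists_isCycle_of_hasNoExit {w : V} {l : List E} (hl : l ≠ []) (hlp : G.IsPath w l w)
    (hle : G.HasNoExit l) :
    ∃ c, G.IsCycle c ∧ G.IsPath w c w ∧ G.HasNoExit c ∧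
      ∀ m, G.IsPath w m w → G.HasNoExit m → ∃ k, m = (List.replicate k c).flatten := by
  classical
  -- The cycle is a shortest nonempty closed path at `w` without exits.
  have hex : ∃ n, ∃ c : List E, c.length = n ∧ c ≠ [] ∧ G.IsPath w c w ∧ G.HasNoExit c :=
    ⟨_, l, rfl, hl, hlp, hle⟩
  obtain ⟨c, hcn, hc, hcp, hce⟩ := Nat.find_spec hex
  have hmin (m : List E) (hm : m ≠ []) (hmp : G.IsPath w m w) (hme : G.HasNoExit m) :
      c.length ≤ m.length := hcn ▸ Nat.find_min' hex ⟨m, rfl, hm, hmp, hme⟩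
  refine ⟨c, ⟨hc, hcp.isChain, ?_, ?_⟩, hcp, hce, fun m hmp hme => ?_⟩
  · rw [hcp.range_getLast]
    cases c with
    | nil => exact absurd rfl hc
    | cons e c => exact hcp.1.symm
  -- Without exits a repeated source is a repeated edge, and cutting out the loop between the two
  -- occurrences would give a shorter closed path.
  · refine List.Nodup.map_on (fun a ha b hb hab => hce b hb a hab) ?_
    by_contra hnd
    obtain ⟨p, a, q, r, rfl⟩ := List.exists_eq_append_of_not_nodup hnd
    obtain ⟨u, hp, ha, hqr⟩ := isPath_append.1 hcp
    obtain ⟨u', -, hr⟩ := isPath_append.1 hqr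
    have := hmin (p ++ a :: r) (by simp)
      (isPath_append.2 ⟨u, hp, ha, hr.2⟩) fun e he => hce e (by
        simp only [List.mem_append, List.mem_cons] at he ⊢
        tauto)
    simp at this
    omega
  -- Edges are forced, so `c` is a prefix of every nonempty such `m`, and the remainder is again a
  -- closed path at `w`.
  · induction hn : m.length using Nat.strong_induction_on generalizing m with
    | _ n ih =>
      by_cases hm : m = []
      · exact ⟨0, by simp [hm]⟩
      · obtain ⟨m', rfl⟩ := hce.exists_eq_append hcp hmp (hmin m hm hmp hme)
        obtain ⟨u, hu, hmp'⟩ := isPath_append.1 hmp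
        rw [← hcp.unique hu] at hmp'
        have hpos := List.length_pos_iff.2 hc
        obtain ⟨k, hk⟩ := ih m'.length (by simp at hn; omega) m' hmp'
          (fun e he => hme e (by simp [he])) rfl
        exact ⟨k + 1, by rw [List.replicate_succ, List.flatten_cons, ← hk]⟩

namespace LeavittPathAlgebra

variable {K : Type*} [Field K]

theorem ghost_mul_evalFrom {v : V} {e : E} (he : G.s e = v) (y : List E →₀ K) :
    ghost K G e * evalFrom K G v y = y [] • ghost K G e +
      evalFrom K G (G.r e) (Finsupp.lcomapDomain (M := K) (R := K) (e :: ·) List.cons_injective y) := by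
  classical
  induction y using Finsupp.induction_linear with
  | zero => simp
  | add y y' h h' =>
    simp only [map_add, mul_add, h, h', Finsupp.add_apply, add_smul]
    abel
  | single l k =>
    simp only [evalFrom, Finsupp.linearCombination_single, mul_smul_comm]
    cases l with
    | nil =>
      have : Finsupp.lcomapDomain (M := K) (R := K) (e :: ·) List.cons_injective
          (Finsupp.single ([] : List E) k) = 0 := by
        ext l; simp [Finsupp.lcomapDomain]
      rw [this, map_zero, add_zero, Finsupp.single_eq_same, pathFrom, ← he, ghost_mul_vertex]
    | cons f l =>
      by_cases hf : e = f
      · subst hf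
        have : Finsupp.lcomapDomain (M := K) (R := K) (e :: ·) List.cons_injective
            (Finsupp.single (e :: l) k) = Finsupp.single l k := by
          ext m; simp [Finsupp.lcomapDomain, Finsupp.single_apply]
        rw [this, Finsupp.linearCombination_single, pathFrom_cons he, ← mul_assoc,
          ghost_mul_edge_self, vertex_mul_pathFrom]
        simp
      · have : Finsupp.lcomapDomain (M := K) (R := K) (e :: ·) List.cons_injective
            (Finsupp.single (f :: l) k) = 0 := by
          ext m; simp [Finsupp.lcomapDomain, Ne.symm hf]
        rw [this, map_zero, pathFrom, ← mul_assoc, ← mul_assoc, ← he, ghost_mul_vertex,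
          ghost_mul_edge_of_ne hf]
        simp

/-- A formal linear combination of closed paths at `w` with nonzero constant term whose value lies
in `I`. -/
structure IsReduced (I : Submodule K (LeavittPathAlgebra K G)) (w : V) (y : List E →₀ K) :
    Prop where
  isPath : ∀ l ∈ y.support, G.IsPath w l w
  nil_mem : [] ∈ y.support
  mem : evalFrom K G w y ∈ I

variable {I : Submodule K (LeavittPathAlgebra K G)}

/-- Left multiplication by the ghosts of the successive edges of `l` shortens `l` and keeps its
coefficient. Stop as soon as the empty path occurs: then source and range agree, and all paths are
closed. -/
theorem exists_isReduced (hleft : ∀ x ∈ I, ∀ a, a * x ∈ I) {l : List E} {v w : V}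
    {y : List E →₀ K} (hy : ∀ l ∈ y.support, G.IsPath v l w) (hyI : evalFrom K G v y ∈ I)
    (hl : l ∈ y.support) : ∃ w y, IsReduced I w y := by
  by_cases h0 : [] ∈ y.support
  · obtain rfl : v = w := hy _ h0
    exact ⟨v, y, hy, h0, hyI⟩
  induction l generalizing v y with
  | nil => exact absurd hl h0
  | cons e l ih =>
    have he : G.s e = v := (hy _ hl).1
    set y' := Finsupp.lcomapDomain (M := K) (R := K) (e :: ·) List.cons_injective y with hy'
    have hmem (m : List E) : m ∈ y'.support ↔ e :: m ∈ y.support := by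
      simp [hy', Finsupp.lcomapDomain]
    have hpath : ∀ m ∈ y'.support, G.IsPath (G.r e) m w := fun m hm => (hy _ ((hmem m).1 hm)).2
    have hI : evalFrom K G (G.r e) y' ∈ I := by
      have := hleft _ hyI (ghost K G e)
      rwa [ghost_mul_evalFrom he, Finsupp.notMem_support_iff.1 h0, zero_smul, zero_add] at this
    by_cases h1 : [] ∈ y'.support
    · have h2 : G.r e = w := hpath _ h1
      exact ⟨G.r e, y', h2 ▸ hpath, h1, hI⟩
    · exact ih hpath hI ((hmem l).2 hl) h1

open Classical in
/-- The effect on coefficients of conjugating a combination of closed paths with the edge `e`. -/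
noncomputable def conjugate (e : E) (y : List E →₀ K) : List E →₀ K :=
  (y.filter fun l => ∀ f ∈ l.head?, f = e).mapDomain fun l => l.rotate 1

theorem support_conjugate [DecidableEq E] (e : E) (y : List E →₀ K) :
    (conjugate e y).support =
      {l ∈ y.support | ∀ f ∈ l.head?, f = e}.image fun l => l.rotate 1 := by
  classical
  rw [conjugate, Finsupp.mapDomain_support_of_injective (List.rotate_injective 1),
    Finsupp.support_filter]
  congr!

/-- Here `e* (e α) e = α e` is a rotation, and a path starting with another edge is killed. For the
empty path the condition on `head?` is vacuous, matching `e* w e = r(e)`; thus the constant term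
survives. -/
theorem evalFrom_conjugate {w : V} {e : E} (he : G.s e = w) {y : List E →₀ K}
    (hy : ∀ l ∈ y.support, G.IsPath w l w) :
    evalFrom K G (G.r e) (conjugate e y) = ghost K G e * evalFrom K G w y * edge K G e := by
  classical
  rw [evalFrom, conjugate, Finsupp.linearCombination_mapDomain, Finsupp.linearCombination_apply,
    evalFrom, Finsupp.linearCombination_apply, Finsupp.sum, Finsupp.sum, Finsupp.support_filter,
    Finset.sum_filter, Finset.mul_sum, Finset.sum_mul]
  refine Finset.sum_congr rfl fun l hl => ?_
  rw [mul_smul_comm, smul_mul_assoc, Function.comp_apply]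
  split_ifs with h
  · rw [Finsupp.filter_apply_pos _ _ h]
    congr 1
    cases l with
    | nil =>
      simp only [List.rotate_nil, pathFrom]
      rw [← he, ghost_mul_vertex, ghost_mul_edge_self]
    | cons f l =>
      obtain rfl : f = e := h f rfl
      rw [pathFrom_cons he, ← mul_assoc, ghost_mul_edge_self, vertex_mul_pathFrom,
        pathFrom_mul_edge (hy _ hl).2 he]
      simp
  · cases l with
    | nil => simp at h
    | cons f l =>
      have hef : e ≠ f := fun hef => h (by simp [hef])
      rw [pathFrom, ← mul_assoc, ← mul_assoc, ← he, ghost_mul_vertex, ghost_mul_edge_of_ne hef,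
        zero_mul, zero_mul, smul_zero]

theorem IsReduced.conjugate (hleft : ∀ x ∈ I, ∀ a, a * x ∈ I)
    (hright : ∀ x ∈ I, ∀ a, x * a ∈ I) {w : V} {y : List E →₀ K} (h : IsReduced I w y) {e : E}
    (he : G.s e = w) : IsReduced I (G.r e) (conjugate e y) := by
  classical
  refine ⟨fun l hl => ?_, ?_, ?_⟩
  · rw [support_conjugate] at hl
    obtain ⟨m, hm, rfl⟩ := Finset.mem_image.1 hl
    obtain ⟨hmy, hme⟩ := Finset.mem_filter.1 hm
    cases m with
    | nil => simp
    | cons f m =>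
      obtain rfl : f = e := hme f rfl
      simpa using isPath_append.2 ⟨w, (h.isPath _ hmy).2, isPath_cons.2 ⟨he, isPath_nil.2 rfl⟩⟩
  · rw [support_conjugate]
    exact Finset.mem_image.2 ⟨[], Finset.mem_filter.2 ⟨h.nil_mem, by simp⟩, by simp⟩
  · rw [evalFrom_conjugate he h.isPath]
    exact hright _ (hleft _ h.mem _) _

/-- If an ideal contains a reduced element, then it contains one all of whose paths have no
exits. -/
theorem IsReduced.exists_hasNoExit (hleft : ∀ x ∈ I, ∀ a, a * x ∈ I)
    (hright : ∀ x ∈ I, ∀ a, x * a ∈ I) {w : V} {y : List E →₀ K} (h : IsReduced I w y) :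
    ∃ w y, IsReduced I w y ∧ ∀ l ∈ y.support, G.HasNoExit l := by
  classical
  have hex : ∃ n, ∃ w y, IsReduced I w y ∧ y.support.card = n := ⟨_, w, y, h, rfl⟩
  have hmin {w : V} {y : List E →₀ K} (h : IsReduced I w y) : Nat.find hex ≤ y.support.card :=
    Nat.find_min' hex ⟨w, y, h, rfl⟩
  set N := Nat.find hex with hN
  -- By minimality conjugation by any edge `e` leaving `w` loses no term, so all nonempty paths in
  -- the support begin with `e`.
  have key {w : V} {y : List E →₀ K} (h : IsReduced I w y) (hc : y.support.card = N) {e : E}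
      (he : G.s e = w) : (∀ l ∈ y.support, ∀ f ∈ l.head?, f = e) ∧
        (DirectedGraph.LeavittPathAlgebra.conjugate e y).support =
          y.support.image fun l => l.rotate 1 := by
    have h1 := hmin (h.conjugate hleft hright he)
    have h2 : {l ∈ y.support | ∀ f ∈ l.head?, f = e} = y.support := by
      refine Finset.eq_of_subset_of_card_le (Finset.filter_subset _ _) ?_
      rw [hc]
      refine h1.trans ?_
      rw [support_conjugate]
      exact Finset.card_image_le
    exact ⟨Finset.filter_eq_self.1 h2, by rw [support_conjugate, h2]⟩
  -- Conjugation preserves minimality, so any edge of a path can be rotated to the front, where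
  -- `key` shows that it has no competitor.
  have hrot {l : List E} (k : ℕ) : (∃ w y, IsReduced I w y ∧ y.support.card = N ∧ l ∈ y.support) →
      ∃ w y, IsReduced I w y ∧ y.support.card = N ∧ l.rotate k ∈ y.support := by
    intro hl
    induction k with
    | zero => simpa using hl
    | succ k ih =>
      obtain ⟨w, y, h, hc, hk⟩ := ih
      rw [← List.rotate_rotate]
      rcases hm : l.rotate k with - | ⟨e, m⟩
      · exact ⟨w, y, h, hc, by simpa using h.nil_mem⟩
      · rw [hm] at hk
        have he := (h.isPath _ hk).1
        have hs := (key h hc he).2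
        refine ⟨_, _, h.conjugate hleft hright he, ?_, ?_⟩
        · rw [hs, Finset.card_image_of_injective _ (List.rotate_injective 1), hc]
        · rw [hs]; exact Finset.mem_image_of_mem _ hk
  obtain ⟨w, y, h, hc⟩ := Nat.find_spec hex
  refine ⟨w, y, h, fun l hl e he f hf => ?_⟩
  obtain ⟨p, q, rfl⟩ := List.append_of_mem he
  obtain ⟨w', y', h', hc', hl'⟩ := hrot p.length ⟨w, y, h, hc, hl⟩
  rw [List.rotate_append_length_eq] at hl'
  exact ((key h' hc' (hf.trans (h'.isPath _ hl').1)).1 _ hl' e rfl).symm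

theorem pathFrom_flatten_replicate {w : V} {c : List E} (hc : G.IsPath w c w) (k : ℕ) :
    pathFrom K G w (List.replicate k c).flatten =
      (LinearMap.mulLeft K (pathFrom K G w c) ^ k) (vertex K G w) := by
  induction k with
  | zero => rfl
  | succ k ih =>
    rw [List.replicate_succ, List.flatten_cons, ← pathFrom_mul_pathFrom hc, ih, pow_succ',
      Module.End.mul_apply, LinearMap.mulLeft_apply]

open Polynomial in
/-- A nonzero two-sided ideal of `L_K(E)` containing no vertices contains a nonzero polynomial in
a cycle without exits. -/
theorem exists_polynomial_mem (hleft : ∀ x ∈ I, ∀ a, a * x ∈ I)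
    (hright : ∀ x ∈ I, ∀ a, x * a ∈ I) (hvertex : ∀ v, vertex K G v ∉ I)
    {x : LeavittPathAlgebra K G} (hxI : x ∈ I) (hx : x ≠ 0) :
    ∃ e l, G.IsCycle (e :: l) ∧ (¬ ∃ f, G.IsExit f (e :: l)) ∧ ∃ p : K[X], p ≠ 0 ∧
      aeval (LinearMap.mulLeft K (path K G e l)) p (vertex K G (G.s e)) ∈ I := by
  classical
  obtain ⟨v, w, y, hy, hyI, hy0⟩ := exists_evalFrom_mem_of_ne_zero hleft hright hxI hx
  obtain ⟨l, hl⟩ := Finsupp.support_nonempty_iff.2 hy0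
  obtain ⟨w, y, h⟩ := exists_isReduced hleft hy hyI hl
  obtain ⟨w, y, h, hne⟩ := h.exists_hasNoExit hleft hright
  have hy0 : y [] ≠ 0 := Finsupp.mem_support_iff.1 h.nil_mem
  -- Otherwise `y` is a nonzero multiple of a vertex, which `I` does not contain.
  obtain ⟨l, hl, hl0⟩ : ∃ l ∈ y.support, l ≠ [] := by
    by_contra! hall
    have hys : y = Finsupp.single [] (y []) := by
      rw [← Finsupp.support_subset_singleton]
      exact fun l hl => Finset.mem_singleton.2 (hall l hl)
    have := h.mem
    rw [hys, evalFrom, Finsupp.linearCombination_single, I.smul_mem_iff hy0] at this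
    exact hvertex w this
  obtain ⟨c, hc, hcp, hce, hpow⟩ := exists_isCycle_of_hasNoExit hl0 (h.isPath l hl) (hne l hl)
  choose! k hk using fun m (hm : m ∈ y.support) => hpow m (h.isPath m hm) (hne m hm)
  have hkz (m : List E) (hm : m ∈ y.support) (hkm : k m = 0) : m = [] := by
    rw [hk m hm, hkm]; rfl
  have hk0 : k [] = 0 := by
    by_contra hk0
    have := hk [] h.nil_mem
    rw [← Nat.succ_pred_eq_of_ne_zero hk0, List.replicate_succ, List.flatten_cons] at this
    exact hc.1 (List.append_eq_nil_iff.1 this.symm).1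
  cases c with
  | nil => exact absurd rfl hc.1
  | cons e c =>
    obtain rfl : G.s e = w := hcp.1
    -- The polynomial is nonzero because its constant coefficient is `y []`: only the empty path has
    -- exponent zero.
    refine ⟨e, c, hc, hce.not_isExit, ∑ m ∈ y.support, monomial (k m) (y m), fun hp => ?_, ?_⟩
    · apply hy0
      have := congrArg (coeff · 0) hp
      simp only [finsetSum_coeff, coeff_monomial, coeff_zero] at this
      rw [Finset.sum_eq_single []] at this
      · simpa [hk0] using this
      · exact fun m hm hm0 => if_neg fun hkm => hm0 (hkz m hm hkm)
      · exact fun hn => absurd h.nil_mem hn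
    · have := h.mem
      rw [evalFrom, Finsupp.linearCombination_apply, Finsupp.sum] at this
      convert this using 1
      rw [map_sum, LinearMap.sum_apply]
      refine Finset.sum_congr rfl fun m hm => ?_
      conv_rhs => rw [hk m hm]
      rw [pathFrom_flatten_replicate hcp, aeval_monomial, path_eq_pathFrom hcp.isChain,
        Module.End.mul_apply, Module.algebraMap_end_apply, ← hk m hm]

end LeavittPathAlgebra

end DirectedGraph
-- The equations `z + xz = 0` and `w + xw = x` for homogeneous `x`
section Graded

variable {R A : Type*} [CommRing R] [NonUnitalRing A] [Module R A]
  {𝒜 : ℤ → Submodule R A}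

theorem decompose_mul_add_of_mem [DirectSum.Decomposition 𝒜] [SetLike.GradedMul 𝒜] {n : ℤ} {x : A}
    (hx : x ∈ 𝒜 n) (z : A) (i : ℤ) :
    (DirectSum.decompose 𝒜 (x * z) (n + i) : A) = x * DirectSum.decompose 𝒜 z i := by
  induction z using DirectSum.Decomposition.inductionOn 𝒜 with
  | zero => simp
  | @homogeneous j z =>
    have hxz : x * z ∈ 𝒜 (n + j) := SetLike.GradedMul.mul_mem hx z.2
    by_cases hij : j = i
    · subst hij
      rw [DirectSum.decompose_of_mem_same 𝒜 hxz, DirectSum.decompose_of_mem_same 𝒜 z.2]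
    · rw [DirectSum.decompose_of_mem_ne 𝒜 hxz (by omega),
        DirectSum.decompose_of_mem_ne 𝒜 z.2 hij, mul_zero]
  | add a b ha hb =>
    simp only [mul_add, DirectSum.decompose_add, DirectSum.add_apply, Submodule.coe_add, ha, hb]

theorem exists_decompose_eq_zero [DirectSum.Decomposition 𝒜] (z : A) {n : ℤ} (hn : n ≠ 0)
    (a : ℤ) : ∃ k : ℕ, (DirectSum.decompose 𝒜 z (a + k * n) : A) = 0 := by
  classical
  by_contra! h
  refine Set.infinite_range_of_injective (f := fun k : ℕ => a + k * n) ?_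
    ((DirectSum.decompose 𝒜 z).support.finite_toSet.subset ?_)
  · intro k l hkl
    simpa [hn] using hkl
  · rintro _ ⟨k, rfl⟩
    simpa using fun h0 => h k (by simp [h0])

/-- The recursion is required only strictly below `a` along the progression; for `a = 0` this avoids
the one index where the inhomogeneous equation breaks it. -/
theorem apply_eq_zero_of_progression {f : ℤ → A} {n a : ℤ} {k : ℕ}
    (hstep : ∀ j : ℕ, f (a + (j + 1) * -n) = 0 → f (n + (a + (j + 1) * -n)) = 0)
    (h : f (a + k * -n) = 0) : f a = 0 := by
  induction k with
  | zero => simpa using h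
  | succ k ih =>
    apply ih
    have := hstep k (by exact_mod_cast h)
    rwa [show n + (a + ((k : ℤ) + 1) * -n) = a + k * -n by ring] at this

/-- Components satisfy `z_{n+i} = -x z_i`. Going back by steps of `n` from any index reaches a zero
component, and vanishing propagates forward. -/
theorem eq_zero_of_add_mul_eq_zero (h𝒜 : DirectSum.IsInternal 𝒜) [SetLike.GradedMul 𝒜] {n : ℤ}
    (hn : n ≠ 0) {x : A} (hx : x ∈ 𝒜 n) {z : A} (hz : z + x * z = 0) : z = 0 := by
  classical
  let := h𝒜.chooseDecomposition
  have hstep (i : ℤ) : (DirectSum.decompose 𝒜 z (n + i) : A) = -(x * DirectSum.decompose 𝒜 z i) := by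
    rw [← decompose_mul_add_of_mem hx, eq_neg_iff_add_eq_zero, ← Submodule.coe_add,
      ← DirectSum.add_apply, ← DirectSum.decompose_add, hz]
    simp
  rw [← DirectSum.sum_support_decompose 𝒜 z]
  refine Finset.sum_eq_zero fun i _ => ?_
  obtain ⟨k, hk⟩ := exists_decompose_eq_zero (𝒜 := 𝒜) z (neg_ne_zero.2 hn) i
  refine apply_eq_zero_of_progression (f := fun i => (DirectSum.decompose 𝒜 z i : A))
    (fun j hj => ?_) hk
  dsimp only at hj ⊢
  rw [hstep, hj, mul_zero, neg_zero]

/-- Backward steps from degree `0` give `w_0 = 0`, hence `w_n = x`; forward steps give `w_{n+kn} =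
±x^{k+1}`, which vanishes for some `k`. -/
theorem isNonUnitalNilpotent_of_add_mul_eq_self (h𝒜 : DirectSum.IsInternal 𝒜)
    [SetLike.GradedMul 𝒜] {n : ℤ} (hn : n ≠ 0) {x : A} (hx : x ∈ 𝒜 n) {w : A}
    (hw : w + x * w = x) : IsNonUnitalNilpotent x := by
  classical
  let := h𝒜.chooseDecomposition
  have hsum (i : ℤ) : (DirectSum.decompose 𝒜 w (n + i) : A) + x * DirectSum.decompose 𝒜 w i =
      DirectSum.decompose 𝒜 x (n + i) := by
    rw [← decompose_mul_add_of_mem hx, ← Submodule.coe_add,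
      ← DirectSum.add_apply, ← DirectSum.decompose_add, hw]
  have hstep (i : ℤ) (hi : i ≠ 0) :
      (DirectSum.decompose 𝒜 w (n + i) : A) = -(x * DirectSum.decompose 𝒜 w i) := by
    rw [eq_neg_iff_add_eq_zero, hsum, DirectSum.decompose_of_mem_ne 𝒜 hx (by omega)]
  have hzero : (DirectSum.decompose 𝒜 w 0 : A) = 0 := by
    obtain ⟨k, hk⟩ := exists_decompose_eq_zero (𝒜 := 𝒜) w (neg_ne_zero.2 hn) 0
    refine apply_eq_zero_of_progression (f := fun i => (DirectSum.decompose 𝒜 w i : A))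
      (fun j hj => ?_) hk
    dsimp only at hj ⊢
    rw [hstep _ (by rw [zero_add]; exact mul_ne_zero (by omega) (neg_ne_zero.2 hn)), hj,
      mul_zero, neg_zero]
  obtain ⟨k, hk⟩ := exists_decompose_eq_zero (𝒜 := 𝒜) w hn n
  obtain ⟨f, hf⟩ : ∃ f : ℤ → A, ∀ i, (DirectSum.decompose 𝒜 w i : A) = f i := ⟨_, fun _ => rfl⟩
  have hbase : f n = x := by
    have := hsum 0
    rw [hzero, mul_zero, add_zero, hf, add_zero, DirectSum.decompose_of_mem_same 𝒜 hx] at this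
    exact this
  simp only [hf] at hstep hk
  have hpow (k : ℕ) : f (n + k * n) = (fun y => x * y)^[k] x ∨
      f (n + k * n) = -(fun y => x * y)^[k] x := by
    induction k with
    | zero => simp [hbase]
    | succ k ih =>
      have h := hstep (n + k * n) (by
        rw [← one_add_mul]; exact mul_ne_zero (by omega) hn)
      have he : n + (k + 1 : ℕ) * n = n + (n + k * n) := by push_cast; ring
      rw [he, h, Function.iterate_succ_apply']
      rcases ih with ih | ih <;> rw [ih] <;> simp
  refine ⟨k, ?_⟩
  rcases hpow k with h | h <;> rw [hk] at h
  · exact h.symm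
  · exact neg_eq_zero.1 h.symm

end Graded
-- No polynomial in the cycle lies in the kernel
namespace DirectedGraph.LeavittPathAlgebra

variable {K : Type*} [Field K] {V E : Type*} {G : DirectedGraph V E}

/-- The kernel of a ring homomorphism on `L_K(E)` is stable under scalars, as `L_K(E)` has local
units. -/
noncomputable def kernel {A : Type*} [NonUnitalRing A] (π : LeavittPathAlgebra K G →ₙ+* A) :
    Submodule K (LeavittPathAlgebra K G) where
  carrier := {x | π x = 0}
  add_mem' {x y} hx hy := by
    rw [Set.mem_ofPred_eq] at *
    rw [map_add, hx, hy, add_zero]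
  zero_mem' := map_zero π
  smul_mem' k x hx := by
    rw [Set.mem_ofPred_eq] at *
    obtain ⟨S, hS⟩ := exists_local_unit x
    -- The scalar moves onto the local unit: `k x = x (k u)`.
    rw [← (hS S subset_rfl).2, ← mul_smul_comm, map_mul, hx, zero_mul]

theorem mem_kernel {A : Type*} [NonUnitalRing A] {π : LeavittPathAlgebra K G →ₙ+* A}
    {x : LeavittPathAlgebra K G} : x ∈ kernel π ↔ π x = 0 := Iff.rfl

open Polynomial in
/-- The kernel of `π` contains no nonzero polynomial in an element `c` if `1 + π c` acts
injectively, but not surjectively. -/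
theorem aeval_mulLeft_notMem_kernel {A : Type*} [NonUnitalRing A]
    {π : LeavittPathAlgebra K G →ₙ+* A} {c u : LeavittPathAlgebra K G} (huc : u * c = c)
    (hinj : ∀ z, z + π c * z = 0 → z = 0) (hsurj : ∀ w, w + π c * w ≠ π c) {p : K[X]}
    (hp : p ≠ 0) : aeval (LinearMap.mulLeft K c) p u ∉ kernel π := by
  set T := LinearMap.mulLeft K c with hT
  have hstable (a : K[X]) {x : LeavittPathAlgebra K G} (hx : x ∈ kernel π) :
      aeval T a x ∈ kernel π := by
    induction a using Polynomial.induction_on' with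
    | add a b ha hb => rw [map_add]; exact add_mem ha hb
    | monomial n k =>
      rw [aeval_monomial, Module.End.mul_apply, Module.algebraMap_end_apply]
      refine Submodule.smul_mem _ _ ?_
      induction n with
      | zero => exact hx
      | succ n ih =>
        rw [pow_succ', Module.End.mul_apply, hT, LinearMap.mulLeft_apply, mem_kernel, map_mul,
          mem_kernel.1 ih, mul_zero]
  have hX (z : LeavittPathAlgebra K G) : aeval T (X + C 1 : K[X]) z = z + c * z := by
    simp [hT, add_comm]
  intro hmem
  -- Split off all factors `X + 1`; injectivity of `1 + π c` cancels them one at a time.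
  obtain ⟨q, hpq, hq⟩ := exists_eq_pow_rootMultiplicity_mul_and_not_dvd p hp (-1)
  rw [C_neg, sub_neg_eq_add] at hpq hq
  have hqmem : aeval T q u ∈ kernel π := by
    rw [hpq] at hmem
    generalize rootMultiplicity (-1) p = m at hmem
    clear hpq
    induction m with
    | zero => simpa using hmem
    | succ m ih =>
      apply ih
      rw [pow_succ', mul_assoc, map_mul (aeval T) (X + C 1), Module.End.mul_apply, hX, mem_kernel,
        map_add, map_mul π] at hmem
      exact hinj _ hmem
  have hirr : Irreducible (X + C 1 : K[X]) := irreducible_of_degree_eq_one (degree_X_add_C 1)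
  obtain ⟨b, a, hab⟩ := hirr.coprime_iff_not_dvd.2 hq
  have hbez : aeval T a (aeval T q u) + (aeval T b u + c * aeval T b u) = u := by
    rw [← hX, ← Module.End.mul_apply, ← Module.End.mul_apply, ← map_mul, ← map_mul,
      ← LinearMap.add_apply, ← map_add, mul_comm (X + C 1), add_comm, hab, map_one, Module.End.one_apply]
  -- Multiply the Bézout relation by `c` on the right and apply `π`: the `q` term dies, and `u c =
  -- c`.
  refine hsurj (π (aeval T b u * c)) ?_
  have := congrArg (fun z => π (z * c)) hbez
  simp only [huc, map_mul, map_add, mem_kernel.1 (hstable a hqmem), add_mul, zero_mul, zero_add] at this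
  rw [map_mul, ← mul_assoc]
  exact this

end DirectedGraph.LeavittPathAlgebra

theorem mainTheorem9 {K : Type*} [Field K] {V E : Type*} (G : DirectedGraph V E)
    {A : Type*} [NonUnitalRing A] [Module K A] [IsScalarTower K A A] [SMulCommClass K A A]
    (𝒜 : ℤ → Submodule K A) (h𝒜 : DirectSum.IsInternal 𝒜) [SetLike.GradedMul 𝒜]
    (π : DirectedGraph.LeavittPathAlgebra K G →ₙ+* A)
    (hvertex : ∀ v : V, π (DirectedGraph.LeavittPathAlgebra.vertex K G v) ≠ 0)
    (hcycle : ∀ (e : E) (l : List E), G.IsCycle (e :: l) → (¬ ∃ f : E, G.IsExit f (e :: l)) →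
      ¬ IsNonUnitalNilpotent (π (DirectedGraph.LeavittPathAlgebra.path K G e l)) ∧
        ∃ n : ℤ, n ≠ 0 ∧ π (DirectedGraph.LeavittPathAlgebra.path K G e l) ∈ 𝒜 n) :
    Function.Injective π := by
  refine (injective_iff_map_eq_zero π).2 fun x hx => ?_
  by_contra hx0
  obtain ⟨e, l, hc, hne, p, hp, hmem⟩ :=
    DirectedGraph.LeavittPathAlgebra.exists_polynomial_mem
      (I := DirectedGraph.LeavittPathAlgebra.kernel π)
      (fun x hx a => by
        rw [DirectedGraph.LeavittPathAlgebra.mem_kernel] at *; rw [map_mul, hx, mul_zero])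
      (fun x hx a => by
        rw [DirectedGraph.LeavittPathAlgebra.mem_kernel] at *; rw [map_mul, hx, zero_mul])
      hvertex hx hx0
  obtain ⟨hnil, n, hn, hdeg⟩ := hcycle e l hc hne
  refine DirectedGraph.LeavittPathAlgebra.aeval_mulLeft_notMem_kernel ?_
    (fun z => eq_zero_of_add_mul_eq_zero h𝒜 hn hdeg)
    (fun w hw => hnil (isNonUnitalNilpotent_of_add_mul_eq_self h𝒜 hn hdeg hw)) hp hmem
  obtain ⟨_, hchain, _⟩ := hc
  rw [DirectedGraph.LeavittPathAlgebra.path_eq_pathFrom hchain,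
    DirectedGraph.LeavittPathAlgebra.vertex_mul_pathFrom]
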